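/- Let $\mathbb{R}^n$ carry its Euclidean inner product and norm (and the induced operator norms on linear and multilinear maps), let $B(a,\delta)$ denote the open ball, let $\Omega\subset\mathbb{R}^n$ be open, $C\subset\Omega$ convex and compact, and $F:\Omega\to\mathbb{R}^n$ analytic. Let $x_*\in C$ satisfy $F(x_*)=0$ with $F'(x_*)$ nonsingular, and assume $$\gamma:=\sup_{m>1}\left\|\frac{F'(x_*)^{-1}F^{(m)}(x_*)}{m!}\right\|^{1/(m-1)}<+\infty .$$ **CondG procedure** $z=\mathrm{CondG}(y,x,\varepsilon)$, for $x\in C$, $\varepsilon\ge 0$. Put $z_1=x$. For $t=1,2,\dots$, let $u_t$ be any minimizer of $u\mapsto\langle z_t-y,u-z_t\rangle$ over $C$ and $g_t^*$ the minimum. If $g_t^*\ge-\varepsilon$, stop with output $z=z_t$; otherwise set $z_{t+1}=z_t+\alpha_t(u_t-z_t)$ with $\alpha_t=\min\{1,-g_t^*/\|u_t-z_t\|^2\}$. If the procedure never stops, its output is understood to be $\lim_t z_t$. **Newton-CondG method.** Given $x_0\in C$ and $\{\theta_k\}\subset[0,\infty)$, for $k=0,1,\dots$: if $F(x_k)=0$,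 stop (we then put $x_j=x_k$ for all $j\ge k$); otherwise find $s_k$ with $F'(x_k)s_k=-F(x_k)$ and take $x_{k+1}=\mathrm{CondG}(x_k+s_k,x_k,\theta_k\|s_k\|^2)$. Let $\lambda\in[0,1)$, $\kappa=\sup\{t\in[0,1/\gamma):B(x_*,t)\subset\Omega\}$ and $$\bar r=\min\left\{\kappa,\ \frac{5-3\lambda-\sqrt{(5-3\lambda)^2-8(1-\lambda)^2}}{4(1-\lambda)\gamma}\right\},$$ where $c/0=+\infty$ for $c>0$ if $\gamma=0$. Assume that $\{\theta_k\}\subset[0,\lambda^2/2]$ and $x_0\in (C\cap B(x_*,\bar r))\setminus\{x_*\}$. Then: 1. The method is well defined, whatever minimizers $u_t$ are chosen: at every iterate $x_k$ reached, $F'(x_k)$ is nonsingular; if $F(x_k)\neq0$, then $s_k\ne0$ and the CondG procedure at step $k$ stops after finitely many passes if $\theta_k>0$, and in general (so also if $\theta_k=0$) it either stops after finitely many passes or its inner iterates $z_t$ converge. Hence the method generates a sequence $\{x_k\}$. 2. Every sequence $\{x_k\}$ so generated is contained in $B(x_*,\bar r)\cap C$, converges to $x_*$, and satisfies, for all $k\ge0$,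 $$\|x_{k+1}-x_*\|\le\frac{\gamma}{2(1-\gamma\|x_0-x_*\|)^2-1}\,\|x_k-x_*\|^2+\sqrt{2\theta_k}\,\|x_k-x_*\| .$$ Moreover, if $t_0=\|x_0-x_*\|$, then for all $k\ge0$ $$\|x_{k+1}-x_*\|\le t_{k+1}:=\frac{(1+\lambda)\gamma t_k^2}{2(1-\gamma t_k)^2-1}+\sqrt{2\theta_k}\,t_k .$$ -/

import Mathlib

open Filter Topology
open scoped ENNReal

/-- The space `ℝⁿ` with its standard inner product and the associated norm. -/
abbrev RSpace (n : ℕ) : Type := EuclideanSpace ℝ (Fin n)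

section CondG

variable {n : ℕ}

/-- `u` is an answer of the linear optimization oracle at `z`: a minimizer over `C` of the linear
functional `v ↦ ⟪z - y, v - z⟫`. -/
def IsLOSolution (C : Set (RSpace n)) (y z u : RSpace n) : Prop :=
  u ∈ C ∧ ∀ v ∈ C, inner ℝ (z - y) (u - z) ≤ inner ℝ (z - y) (v - z)

/-- The stopping test of the CondG procedure succeeds at `z`: the minimum `g* = ⟪z - y, u - z⟫`
satisfies `g* ≥ -ε`. -/
def CondGStops (C : Set (RSpace n)) (y : RSpace n) (ε : ℝ) (z : RSpace n) : Prop :=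
  ∃ u, IsLOSolution C y z u ∧ -ε ≤ inner ℝ (z - y) (u - z)

/-- One pass through the loop of the CondG procedure, from `z` to `z'`: the stopping test fails
(`g* < -ε`) and `z' = z + α (u - z)` with `α = min {1, -g* / ‖u - z‖²}`. -/
def CondGStep (C : Set (RSpace n)) (y : RSpace n) (ε : ℝ) (z z' : RSpace n) : Prop :=
  ∃ u, IsLOSolution C y z u ∧ inner ℝ (z - y) (u - z) < -ε ∧
    z' = z + min 1 (-inner ℝ (z - y) (u - z) / ‖u - z‖ ^ 2) • (u - z)

/-- `z` is the (infinite) sequence of inner iterates of an execution of the CondG procedure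
started at `x` which never stops. -/
def IsInfiniteCondGRun (C : Set (RSpace n)) (y x : RSpace n) (ε : ℝ) (z : ℕ → RSpace n) : Prop :=
  z 0 = x ∧ ∀ t, CondGStep C y ε (z t) (z (t + 1))

/-- `w` is an output `CondG(y, x, ε)` of the CondG procedure, for some choice of the answers of the
linear optimization oracle: either the procedure, started at `x`, reaches `w` after finitely many
passes and stops there, or it never stops and its inner iterates converge to `w`. -/
def IsCondGOutput (C : Set (RSpace n)) (y x : RSpace n) (ε : ℝ) (w : RSpace n) : Prop :=
  (Relation.ReflTransGen (CondGStep C y ε) x w ∧ CondGStops C y ε w) ∨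
    ∃ z : ℕ → RSpace n, IsInfiniteCondGRun C y x ε z ∧ Tendsto z atTop (𝓝 w)

/-- The call `CondG(y, x, ε)` is well defined, whatever the answers of the oracle are: the procedure
never gets stuck, it stops after finitely many passes if `ε > 0`, and if an execution does not stop
then its inner iterates converge. -/
structure CondGWellDefined (C : Set (RSpace n)) (y x : RSpace n) (ε : ℝ) : Prop where
  progress : ∀ z, Relation.ReflTransGen (CondGStep C y ε) x z →
    CondGStops C y ε z ∨ ∃ z', CondGStep C y ε z z'
  terminates : 0 < ε → ¬ ∃ z : ℕ → RSpace n, IsInfiniteCondGRun C y x ε z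
  converges : ∀ z : ℕ → RSpace n, IsInfiniteCondGRun C y x ε z →
    ∃ w, Tendsto z atTop (𝓝 w)

/-- `x'` is an iterate following `x` in the Newton-CondG method with parameter `θ`: if `F x = 0`
the method stops, and the last iterate is repeated; otherwise a Newton step `F'(x) s = -F(x)`,
`y = x + s`, is followed by `x' = CondG(y, x, θ ‖s‖²)`. -/
def NewtonCondGStep (F : RSpace n → RSpace n) (C : Set (RSpace n)) (θ : ℝ)
    (x x' : RSpace n) : Prop :=
  (F x = 0 ∧ x' = x) ∨
    (F x ≠ 0 ∧ ∃ s : RSpace n, fderiv ℝ F x s = -F x ∧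
      IsCondGOutput C (x + s) x (θ * ‖s‖ ^ 2) x')

/-- `κ(Ω, R) = sup {t ∈ [0, R) : B(a, t) ⊆ Ω}`. -/
noncomputable def kappa (Ω : Set (RSpace n)) (a : RSpace n) (R : ℝ≥0∞) : ℝ≥0∞ :=
  sSup {t : ℝ≥0∞ | t < R ∧ Metric.eball a t ⊆ Ω}

/-- The Smale constant `sup_{m > 1} ‖F'(a)⁻¹ F⁽ᵐ⁾(a) / m!‖ ^ (1 / (m - 1))`, as an extended
nonnegative real number; the norm is the operator norm of `m`-linear maps. -/
noncomputable def smaleGamma (F : RSpace n → RSpace n) (a : RSpace n) : ℝ≥0∞ :=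
  ⨆ (m : ℕ) (_ : 1 < m),
    ‖((m.factorial : ℝ)⁻¹ • (fderiv ℝ F a).inverse.compContinuousMultilinearMap
        (iteratedFDeriv ℝ m F a))‖ₑ ^ (1 / ((m : ℝ) - 1))

/-- The radius `r̄ = min {κ(Ω, 1/γ), (5 - 3λ - √((5 - 3λ)² - 8(1 - λ)²)) / (4 (1 - λ) γ)}`, with the
convention `c / 0 = ∞` for `c > 0`. -/
noncomputable def smaleRadius (Ω : Set (RSpace n)) (a : RSpace n) (γ : ℝ≥0∞) (lam : ℝ) : ℝ≥0∞ :=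
  min (kappa Ω a (1 / γ))
    (ENNReal.ofReal (5 - 3 * lam - √((5 - 3 * lam) ^ 2 - 8 * (1 - lam) ^ 2)) /
      (ENNReal.ofReal (4 * (1 - lam)) * γ))

end CondG

/-- The scalar sequence `t_{k+1} = (1 + λ) γ t_k² / (2 (1 - γ t_k)² - 1) + √(2 θ_k) t_k`. -/
noncomputable def smaleSeq (γ lam : ℝ) (θ : ℕ → ℝ) (t₀ : ℝ) : ℕ → ℝ
  | 0 => t₀
  | k + 1 => (1 + lam) * γ * smaleSeq γ lam θ t₀ k ^ 2 /
        (2 * (1 - γ * smaleSeq γ lam θ t₀ k) ^ 2 - 1)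
      + √(2 * θ k) * smaleSeq γ lam θ t₀ k

/-! ### The conditional gradient procedure as an inexact projection onto `C`. -/

section CondG

variable {n : ℕ}

/-! Two independent estimates are combined. Write `a` for the zero, `t = ‖x - a‖`, `u = γ t`. Newton
part: the Taylor coefficients of `F'(a)⁻¹ ∘ F` at `a` have identity linear term and norms at most `γ
^ (m-1)`, so comparison with the geometric series and its derivative shows that `F'(x)` is
invertible when `2(1-u)² > 1`, and that the Newton point lies within `N = γt² / (2(1-u)²-1)` of `a`
(`newton_estimate`). Projection part: an output `w` of CondG satisfies the variational inequality of
the projection of `y` up to `ε`, whence `‖w - a‖² ≤ ‖y - a‖² + 2ε` (`IsCondGOutput.norm_sub_sq_le`).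
With `ε = θ‖s‖²` and `‖s‖ ≤ N + t`, `le_add_sqrt_mul_of_sq_le` gives `‖w - a‖ ≤ N + √(2θ) t`,
provided `(1+λ)N ≤ (1-λ)t`. The second term in the minimum defining the radius is what ensures this;
the same inequality makes every step a contraction with one fixed ratio `ρ < 1`. -/

lemma CondGStep.mem {C : Set (RSpace n)} (hC : Convex ℝ C) {y z z' : RSpace n} {ε : ℝ}
    (hε : 0 ≤ ε) (hz : z ∈ C) (h : CondGStep C y ε z z') : z' ∈ C := by
  obtain ⟨u, hu, hg, rfl⟩ := h
  refine hC.add_smul_sub_mem hz hu.1 ⟨le_min zero_le_one ?_, min_le_left _ _⟩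
  exact div_nonneg (by linarith) (sq_nonneg _)

lemma CondGStep.reflTransGen_mem {C : Set (RSpace n)} (hC : Convex ℝ C) {y x z : RSpace n} {ε : ℝ}
    (hε : 0 ≤ ε) (hx : x ∈ C) (h : Relation.ReflTransGen (CondGStep C y ε) x z) : z ∈ C := by
  induction h with
  | refl => exact hx
  | tail _ hstep ih => exact hstep.mem hC hε ih

lemma IsInfiniteCondGRun.mem {C : Set (RSpace n)} (hC : Convex ℝ C) {y x : RSpace n} {ε : ℝ}
    (hε : 0 ≤ ε) (hx : x ∈ C) {z : ℕ → RSpace n} (h : IsInfiniteCondGRun C y x ε z) (t : ℕ) :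
    z t ∈ C := by
  induction t with
  | zero => rw [h.1]; exact hx
  | succ t ih => exact (h.2 t).mem hC hε ih

lemma exists_isLOSolution {C : Set (RSpace n)} (hC : IsCompact C) (hne : C.Nonempty)
    (y z : RSpace n) : ∃ u, IsLOSolution C y z u := by
  obtain ⟨u, hu, hmin⟩ := hC.exists_isMinOn hne
    (f := fun v => inner ℝ (z - y) (v - z)) (by fun_prop)
  exact ⟨u, hu, fun v hv => hmin hv⟩

lemma condGStops_or_exists_step {C : Set (RSpace n)} (hC : IsCompact C) (hne : C.Nonempty)
    (y z : RSpace n) (ε : ℝ) : CondGStops C y ε z ∨ ∃ z', CondGStep C y ε z z' := by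
  obtain ⟨u, hu⟩ := exists_isLOSolution hC hne y z
  rcases le_or_gt (-ε) (inner ℝ (z - y) (u - z)) with h | h
  · exact Or.inl ⟨u, hu, h⟩
  · exact Or.inr ⟨_, u, hu, h, rfl⟩

/-- The Frank-Wolfe gap at `z` is controlled by the decrease of the squared distance to `y`. -/
lemma CondGStep.exists_gap_le {C : Set (RSpace n)} {D : ℝ}
    (hD : ∀ u ∈ C, ∀ v ∈ C, ‖u - v‖ ≤ D) {y z z' : RSpace n} {ε : ℝ} (hε : 0 ≤ ε) (hz : z ∈ C)
    (h : CondGStep C y ε z z') :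
    ∃ G, ε < G ∧ (∀ v ∈ C, inner ℝ (z - y) (z - v) ≤ G) ∧
      G ≤ (‖z - y‖ ^ 2 - ‖z' - y‖ ^ 2) + D * √(‖z - y‖ ^ 2 - ‖z' - y‖ ^ 2) := by
  obtain ⟨u, hu, hg, rfl⟩ := h
  have hD' := hD u hu.1 z hz
  have hin : ∀ v, inner ℝ (z - y) (z - v) = -inner ℝ (z - y) (v - z) := fun v => by
    rw [← inner_neg_right, neg_sub]
  set g : ℝ := inner ℝ (z - y) (u - z) with hgdef
  refine ⟨-g, by linarith, fun v hv => ?_, ?_⟩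
  · rw [hin]; linarith [hu.2 v hv]
  have hpos : 0 < ‖u - z‖ := by
    rw [norm_pos_iff]
    rintro h0
    rw [h0, inner_zero_right] at hgdef
    linarith
  set d := ‖u - z‖
  have hexp : ∀ a : ℝ, ‖z - y‖ ^ 2 - ‖z + a • (u - z) - y‖ ^ 2 = -(2 * a * g) - a ^ 2 * d ^ 2 := by
    intro a
    rw [show z + a • (u - z) - y = (z - y) + a • (u - z) by abel, norm_add_sq_real,
      inner_smul_right, norm_smul, mul_pow, Real.norm_eq_abs, sq_abs]
    ring
  rw [hexp]
  have hD0 : 0 ≤ D := hpos.le.trans hD'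
  -- For a full step the decrease `-2g - d²` is at least `-g`; for a shorter step it is `(g/d)²`, so
  -- `-g` is `d` times its square root.
  rcases le_total 1 (-g / d ^ 2) with h1 | h1
  · rw [min_eq_left h1]
    rw [le_div_iff₀ (by positivity)] at h1
    have := mul_nonneg hD0 (Real.sqrt_nonneg (-(2 * 1 * g) - 1 ^ 2 * d ^ 2))
    linarith
  · rw [min_eq_right h1]
    have e : -(2 * (-g / d ^ 2) * g) - (-g / d ^ 2) ^ 2 * d ^ 2 = (-g / d) ^ 2 := by
      field_simp; ring
    have hgd : 0 ≤ -g / d := div_nonneg (by linarith) hpos.le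
    rw [e, Real.sqrt_sq hgd]
    have h2 : -g = d * (-g / d) := by field_simp
    have h3 : d * (-g / d) ≤ D * (-g / d) := mul_le_mul_of_nonneg_right hD' hgd
    nlinarith [sq_nonneg (-g / d)]

/-- The squared distances to `y` decrease and are bounded below, so their successive differences
tend to zero, and these dominate the gaps. -/
lemma IsInfiniteCondGRun.exists_gap_tendsto {C : Set (RSpace n)} (hC : Convex ℝ C)
    (hcomp : IsCompact C) {y x : RSpace n} {ε : ℝ} (hε : 0 ≤ ε) (hx : x ∈ C)
    {z : ℕ → RSpace n} (h : IsInfiniteCondGRun C y x ε z) :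
    ∃ G : ℕ → ℝ, (∀ t, ε < G t) ∧ (∀ t, ∀ v ∈ C, inner ℝ (z t - y) (z t - v) ≤ G t) ∧
      Tendsto G atTop (𝓝 0) := by
  obtain ⟨D, hD⟩ := Metric.isBounded_iff.1 hcomp.isBounded
  have hD' : ∀ u ∈ C, ∀ v ∈ C, ‖u - v‖ ≤ D := fun u hu v hv => by
    rw [← dist_eq_norm]; exact hD hu hv
  choose G hG1 hG2 hG3 using fun t =>
    (h.2 t).exists_gap_le hD' hε (h.mem hC hε hx t)
  refine ⟨G, hG1, hG2, ?_⟩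
  have hanti : Antitone fun t => ‖z t - y‖ ^ 2 := by
    refine antitone_nat_of_succ_le fun t => ?_
    by_contra! hlt
    have := hG3 t
    -- If the distance grew, the square root of the negative decrease would be `0` by convention,
    -- forcing `G t < 0`.
    rw [Real.sqrt_eq_zero_of_nonpos (by linarith)] at this
    linarith [hG1 t]
  have hlim := tendsto_atTop_ciInf hanti ⟨0, by rintro _ ⟨t, rfl⟩; positivity⟩
  have hdiff : Tendsto (fun t => ‖z t - y‖ ^ 2 - ‖z (t + 1) - y‖ ^ 2) atTop (𝓝 0) := by
    simpa using hlim.sub (hlim.comp (tendsto_add_atTop_nat 1))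
  have hup := hdiff.add ((hdiff.sqrt).const_mul D)
  simp only [Real.sqrt_zero, mul_zero, add_zero] at hup
  exact squeeze_zero (fun t => hε.trans (hG1 t).le) hG3 hup

lemma exists_inner_nonneg_of_isCompact {C : Set (RSpace n)} (hC : Convex ℝ C)
    (hcomp : IsCompact C) (hne : C.Nonempty) (y : RSpace n) :
    ∃ p ∈ C, ∀ v ∈ C, 0 ≤ inner ℝ (p - y) (v - p) := by
  obtain ⟨p, hp, hmin⟩ := exists_norm_eq_iInf_of_complete_convex hne hcomp.isComplete hC y
  refine ⟨p, hp, fun v hv => ?_⟩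
  have := (norm_eq_iInf_iff_real_inner_le_zero hC hp).1 hmin v hv
  rw [← neg_sub y p, inner_neg_left]
  linarith

/-- Gaps above `ε > 0` cannot tend to zero. For convergence, the limit is the projection `p` of `y`
onto `C`: its variational inequality bounds `‖z t - p‖²` by the gap. -/
lemma condGWellDefined {C : Set (RSpace n)} (hC : Convex ℝ C) (hcomp : IsCompact C)
    {y x : RSpace n} {ε : ℝ} (hε : 0 ≤ ε) (hx : x ∈ C) : CondGWellDefined C y x ε where
  progress z _ := condGStops_or_exists_step hcomp ⟨x, hx⟩ y z ε
  terminates := by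
    rintro hpos ⟨z, hz⟩
    obtain ⟨G, hG1, -, hG3⟩ := hz.exists_gap_tendsto hC hcomp hε hx
    exact hpos.not_ge (ge_of_tendsto' hG3 fun t => (hG1 t).le)
  converges := by
    intro z hz
    obtain ⟨G, hG1, hG2, hG3⟩ := hz.exists_gap_tendsto hC hcomp hε hx
    obtain ⟨p, hp, hproj⟩ := exists_inner_nonneg_of_isCompact hC hcomp ⟨x, hx⟩ y
    refine ⟨p, ?_⟩
    have hsq : ∀ t, ‖z t - p‖ ^ 2 ≤ G t := by
      intro t
      have h1 := hG2 t p hp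
      have h2 := hproj (z t) (hz.mem hC hε hx t)
      have h3 : ‖z t - p‖ ^ 2 = inner ℝ (z t - y) (z t - p) - inner ℝ (p - y) (z t - p) := by
        rw [← inner_sub_left, sub_sub_sub_cancel_right, real_inner_self_eq_norm_sq]
      linarith
    have h0 : Tendsto (fun t => √(‖z t - p‖ ^ 2)) atTop (𝓝 0) := by
      simpa using (squeeze_zero (fun t => sq_nonneg _) hsq hG3).sqrt
    simp only [Real.sqrt_sq (norm_nonneg _)] at h0
    exact tendsto_iff_norm_sub_tendsto_zero.2 h0

lemma exists_isCondGOutput {C : Set (RSpace n)} (hC : Convex ℝ C) (hcomp : IsCompact C)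
    {y x : RSpace n} {ε : ℝ} (hε : 0 ≤ ε) (hx : x ∈ C) : ∃ w, IsCondGOutput C y x ε w := by
  have hwd := condGWellDefined (y := y) hC hcomp hε hx
  by_cases hterm : ∃ w, Relation.ReflTransGen (CondGStep C y ε) x w ∧ CondGStops C y ε w
  · obtain ⟨w, hw⟩ := hterm
    exact ⟨w, Or.inl hw⟩
  · push Not at hterm
    choose! f hf using fun z hz => (hwd.progress z hz).resolve_left (hterm z hz)
    have hreach : ∀ t, Relation.ReflTransGen (CondGStep C y ε) x (f^[t] x) := by
      intro t
      induction t with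
      | zero => exact .refl
      | succ t ih => rw [Function.iterate_succ_apply']; exact ih.tail (hf _ ih)
    have hrun : IsInfiniteCondGRun C y x ε fun t => f^[t] x :=
      ⟨rfl, fun t => by simpa only [Function.iterate_succ_apply'] using hf _ (hreach t)⟩
    obtain ⟨w, hw⟩ := hwd.converges _ hrun
    exact ⟨w, Or.inr ⟨_, hrun, hw⟩⟩

lemma IsCondGOutput.mem {C : Set (RSpace n)} (hC : Convex ℝ C) (hcomp : IsCompact C)
    {y x w : RSpace n} {ε : ℝ} (hε : 0 ≤ ε) (hx : x ∈ C) (h : IsCondGOutput C y x ε w) :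
    w ∈ C := by
  rcases h with ⟨h, -⟩ | ⟨z, hz, hlim⟩
  · exact CondGStep.reflTransGen_mem hC hε hx h
  · exact hcomp.isClosed.mem_of_tendsto hlim (.of_forall (hz.mem hC hε hx))

lemma IsCondGOutput.neg_le_inner {C : Set (RSpace n)} (hC : Convex ℝ C) (hcomp : IsCompact C)
    {y x w : RSpace n} {ε : ℝ} (hε : 0 ≤ ε) (hx : x ∈ C) (h : IsCondGOutput C y x ε w)
    {v : RSpace n} (hv : v ∈ C) : -ε ≤ inner ℝ (w - y) (v - w) := by
  rcases h with ⟨-, u, hu, hg⟩ | ⟨z, hz, hlim⟩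
  · exact hg.trans (hu.2 v hv)
  · obtain ⟨G, hG1, hG2, hG3⟩ := hz.exists_gap_tendsto hC hcomp hε hx
    have hle : inner ℝ (w - y) (w - v) ≤ 0 :=
      le_of_tendsto_of_tendsto'
        (((hlim.sub tendsto_const_nhds).inner (hlim.sub tendsto_const_nhds))) hG3
        fun t => hG2 t v hv
    rw [← neg_sub v w, inner_neg_right] at hle
    linarith

/-- Expand `‖y - v‖²` around `w`, bound the cross term by `neg_le_inner`, and drop `‖w - y‖²`. -/
lemma IsCondGOutput.norm_sub_sq_le {C : Set (RSpace n)} (hC : Convex ℝ C) (hcomp : IsCompact C)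
    {y x w : RSpace n} {ε : ℝ} (hε : 0 ≤ ε) (hx : x ∈ C) (h : IsCondGOutput C y x ε w)
    {v : RSpace n} (hv : v ∈ C) : ‖w - v‖ ^ 2 ≤ ‖y - v‖ ^ 2 + 2 * ε := by
  have h1 := h.neg_le_inner hC hcomp hε hx hv
  have h2 : ‖y - v‖ ^ 2 = ‖w - y‖ ^ 2 + 2 * inner ℝ (w - y) (v - w) + ‖w - v‖ ^ 2 := by
    rw [norm_sub_rev w v, ← norm_add_sq_real, norm_sub_rev y v]
    congr 2
    abel
  nlinarith [sq_nonneg ‖w - y‖]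

end CondG

/-! ### Power series with geometrically bounded coefficients. -/

section HomogeneousSeries

variable {E G : Type*} [NormedAddCommGroup E] [NormedSpace ℝ E] [NormedAddCommGroup G]
  [NormedSpace ℝ G]

/-- The derivative at `h` of the homogeneous polynomial `y ↦ f (y, …, y)`. -/
noncomputable def ContinuousMultilinearMap.diagDeriv {m : ℕ}
    (f : ContinuousMultilinearMap ℝ (fun _ : Fin m => E) G) (h : E) : E →L[ℝ] G :=
  (f.linearDeriv fun _ => h) ∘L ContinuousLinearMap.pi fun _ => ContinuousLinearMap.id ℝ E

namespace ContinuousMultilinearMap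

variable {m : ℕ} (f : ContinuousMultilinearMap ℝ (fun _ : Fin m => E) G) (h v : E)

lemma diagDeriv_apply : f.diagDeriv h v = ∑ i, f (Function.update (fun _ => h) i v) := by
  simp [diagDeriv, linearDeriv_apply]

lemma diagDeriv_apply_self : f.diagDeriv h h = (m : ℝ) • f fun _ => h := by
  simp [diagDeriv_apply, ← Nat.cast_smul_eq_nsmul ℝ]

lemma hasFDerivAt_diag : HasFDerivAt (fun y => f fun _ => y) (f.diagDeriv h) h :=
  (f.hasFDerivAt (fun _ => h)).comp h
    (ContinuousLinearMap.pi fun _ : Fin m => ContinuousLinearMap.id ℝ E).hasFDerivAt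

lemma norm_diagDeriv_le : ‖f.diagDeriv h‖ ≤ m * (‖f‖ * ‖h‖ ^ (m - 1)) := by
  refine ContinuousLinearMap.opNorm_le_bound _ (by positivity) fun v => ?_
  rw [diagDeriv_apply]
  have : ∀ i ∈ Finset.univ, ‖f (Function.update (fun _ => h) i v)‖ ≤
      ‖f‖ * ‖h‖ ^ (m - 1) * ‖v‖ := by
    intro i _
    refine (f.le_opNorm _).trans_eq ?_
    rw [mul_assoc, ← Finset.mul_prod_erase _ _ (Finset.mem_univ i), Function.update_self,
      mul_comm ‖v‖]
    congr 2
    rw [Finset.prod_congr rfl fun j hj => by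
      rw [Function.update_of_ne (Finset.ne_of_mem_erase hj)], Finset.prod_const,
      Finset.card_erase_of_mem (Finset.mem_univ i), Finset.card_univ, Fintype.card_fin]
  refine (norm_sum_le_of_le _ this).trans_eq ?_
  simp [mul_assoc]

end ContinuousMultilinearMap

lemma hasSum_natCast_mul_pow_pred {u : ℝ} (hu0 : 0 ≤ u) (hu1 : u < 1) :
    HasSum (fun m : ℕ => (m : ℝ) * u ^ (m - 1)) (1 / (1 - u) ^ 2) := by
  have hn : ‖u‖ < 1 := by rwa [Real.norm_of_nonneg hu0]
  have hne : 1 - u ≠ 0 := by linarith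
  rw [← hasSum_nat_add_iff' 1]
  have := (hasSum_coe_mul_geometric_of_norm_lt_one hn).add (hasSum_geometric_of_norm_lt_one hn)
  convert! this using 1
  · ext m; push_cast; ring
  · simp only [Finset.range_one, Finset.sum_singleton, Nat.cast_zero, zero_mul, sub_zero]
    field_simp; ring

section Bounds

variable {q : FormalMultilinearSeries ℝ E G} {c : ℝ}

/-- The majorant is the differentiated geometric series. No bound on `q 0` is needed, since a
constant has zero derivative. -/
lemma norm_diagDeriv_le_of_norm_le_pow (hc : 0 ≤ c) (hq : ∀ m, 1 ≤ m → ‖q m‖ ≤ c ^ (m - 1))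
    {h : E} {r : ℝ} (hr : ‖h‖ ≤ r) (m : ℕ) :
    ‖(q m).diagDeriv h‖ ≤ m * (c * r) ^ (m - 1) := by
  refine ((q m).norm_diagDeriv_le h).trans ?_
  rcases Nat.eq_zero_or_pos m with rfl | hm
  · simp
  rw [mul_pow]
  gcongr
  exact hq m hm

lemma hasSum_diagDeriv [CompleteSpace G] (hc : 0 ≤ c) (hq : ∀ m, 1 ≤ m → ‖q m‖ ≤ c ^ (m - 1)) {h : E}
    (hh : c * ‖h‖ < 1) :
    HasSum (fun m => (q m).diagDeriv h) (∑' m, (q m).diagDeriv h) :=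
  (Summable.of_norm_bounded (hasSum_natCast_mul_pow_pred (by positivity) hh).summable
    fun m => norm_diagDeriv_le_of_norm_le_pow hc hq le_rfl m).hasSum

lemma hasFDerivAt_tsum_diag [CompleteSpace G] (hc : 0 ≤ c) (hq : ∀ m, 1 ≤ m → ‖q m‖ ≤ c ^ (m - 1)) {h : E}
    (hh : c * ‖h‖ < 1) :
    HasFDerivAt (fun y => ∑' m, q m fun _ => y) (∑' m, (q m).diagDeriv h) h := by
  -- Termwise differentiation needs a uniform majorant on an open ball containing `h`.
  obtain ⟨r, hr, hr1⟩ : ∃ r, ‖h‖ < r ∧ c * r < 1 := by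
    have : ∀ᶠ r in 𝓝[>] ‖h‖, c * r < 1 :=
      ((continuous_const_mul c).tendsto ‖h‖).mono_left nhdsWithin_le_nhds |>.eventually
        (gt_mem_nhds hh)
    exact (this.and self_mem_nhdsWithin).exists.imp fun r h => ⟨h.2, h.1⟩
  have hr0 : 0 < r := (norm_nonneg h).trans_lt hr
  refine hasFDerivAt_tsum_of_isPreconnected (s := Metric.ball 0 r) (x₀ := 0)
    (hasSum_natCast_mul_pow_pred (mul_nonneg hc hr0.le) hr1).summable
    Metric.isOpen_ball (convex_ball 0 r).isPreconnected
    (fun m y _ => (q m).hasFDerivAt_diag y)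
    (fun m y hy => norm_diagDeriv_le_of_norm_le_pow hc hq (mem_ball_zero_iff.1 hy).le m)
    (Metric.mem_ball_self hr0) ?_ (mem_ball_zero_iff.2 hr)
  refine summable_of_ne_finset_zero (s := {0}) fun m hm => ?_
  have : NeZero m := ⟨by simpa using hm⟩
  exact (q m).map_zero

/-- The derivative at `h` of a power series with `‖qₘ‖ ≤ c ^ (m-1)` is close to its linear part. -/
lemma norm_tsum_diagDeriv_sub_le [CompleteSpace G] (hc : 0 ≤ c) (hq : ∀ m, 1 ≤ m → ‖q m‖ ≤ c ^ (m - 1)) {h : E}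
    (hh : c * ‖h‖ < 1) :
    ‖∑' m, (q m).diagDeriv h - (q 1).diagDeriv h‖ ≤ 1 / (1 - c * ‖h‖) ^ 2 - 1 := by
  have h1 := (hasSum_nat_add_iff' 2).2 (hasSum_diagDeriv hc hq hh)
  have h2 := (hasSum_nat_add_iff' 2).2
    (hasSum_natCast_mul_pow_pred (mul_nonneg hc (norm_nonneg h)) hh)
  have h0 : (q 0).diagDeriv h = 0 := by
    ext v; simp [ContinuousMultilinearMap.diagDeriv_apply]
  have := h1.norm_le_of_bounded h2 fun m => norm_diagDeriv_le_of_norm_le_pow hc hq le_rfl _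
  simpa [Finset.sum_range_succ, h0] using this

lemma summable_diag [CompleteSpace G] (hc : 0 ≤ c) (hq : ∀ m, 1 ≤ m → ‖q m‖ ≤ c ^ (m - 1)) {h : E}
    (hh : c * ‖h‖ < 1) : Summable fun m => q m fun _ => h := by
  rw [← summable_nat_add_iff 1]
  refine Summable.of_norm_bounded
    ((summable_geometric_of_lt_one (mul_nonneg hc (norm_nonneg h)) hh).mul_left ‖h‖) fun m => ?_
  refine ((q (m + 1)).le_opNorm _).trans ?_
  rw [Finset.prod_const, Finset.card_univ, Fintype.card_fin, pow_succ', mul_pow, ← mul_assoc,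
    mul_comm _ ‖h‖, mul_assoc]
  gcongr
  exact hq (m + 1) (by lia)

/-- The linearization error at `h` of a power series with `‖qₘ‖ ≤ c ^ (m-1)`. -/
lemma norm_tsum_diagDeriv_apply_sub_le [CompleteSpace G] (hc : 0 ≤ c)
    (hq : ∀ m, 1 ≤ m → ‖q m‖ ≤ c ^ (m - 1)) (hq0 : q 0 = 0) {h : E} (hh : c * ‖h‖ < 1) :
    ‖(∑' m, (q m).diagDeriv h) h - ∑' m, q m fun _ => h‖ ≤
      c * ‖h‖ ^ 2 / (1 - c * ‖h‖) ^ 2 := by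
  have hn : ‖c * ‖h‖‖ < 1 := by rwa [Real.norm_of_nonneg (by positivity)]
  have h1 := ((ContinuousLinearMap.apply ℝ G h).hasSum (hasSum_diagDeriv hc hq hh)).sub
    (summable_diag hc hq hh).hasSum
  have h2 := (hasSum_nat_add_iff' 1).2 h1
  have h3 := (hasSum_coe_mul_geometric_of_norm_lt_one hn).mul_left ‖h‖
  have := h2.norm_le_of_bounded h3 fun m => ?_
  · convert! this using 1
    · simp [ContinuousMultilinearMap.diagDeriv_apply, hq0]
    · ring
  -- Euler's identity for homogeneous polynomials: the degree `m + 1` term contributes `m` times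
  -- itself, and `∑ m uᵐ = u / (1-u)²`.
  · have e : (ContinuousLinearMap.apply ℝ G h) ((q (m + 1)).diagDeriv h) - q (m + 1) (fun _ => h)
        = (m : ℝ) • q (m + 1) fun _ => h := by
      rw [ContinuousLinearMap.apply_apply, ContinuousMultilinearMap.diagDeriv_apply_self]
      push_cast
      rw [add_smul, one_smul, add_sub_cancel_right]
    rw [e, norm_smul, Real.norm_natCast]
    have := ((q (m + 1)).le_opNorm fun _ => h)
    rw [Finset.prod_const, Finset.card_univ, Fintype.card_fin] at this
    have hb : ‖q (m + 1)‖ * ‖h‖ ^ (m + 1) ≤ c ^ m * ‖h‖ ^ (m + 1) := by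
      gcongr
      exact hq (m + 1) (by lia)
    calc _ ≤ (m : ℝ) * (c ^ m * ‖h‖ ^ (m + 1)) := by gcongr; exact this.trans hb
      _ = _ := by ring

lemma le_radius_of_norm_le_pow (hc : 0 ≤ c) (hq : ∀ m, 1 ≤ m → ‖q m‖ ≤ c ^ (m - 1)) {r : ℝ}
    (hr : 0 ≤ r) (hcr : c * r ≤ 1) : ENNReal.ofReal r ≤ q.radius := by
  refine q.le_radius_of_bound (max ‖q 0‖ r) (r := r.toNNReal) fun m => ?_
  rw [Real.coe_toNNReal r hr]
  rcases m with _ | m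
  · simp
  · refine le_max_of_le_right ?_
    calc ‖q (m + 1)‖ * r ^ (m + 1) ≤ c ^ m * r ^ (m + 1) := by
          gcongr; exact hq (m + 1) (by lia)
      _ = (c * r) ^ m * r := by ring
      _ ≤ 1 * r := by gcongr; exact pow_le_one₀ (by positivity) hcr
      _ = r := one_mul r

end Bounds

/-- An analytic function on a ball is the sum of its Taylor series on that ball, if the Taylor
coefficients are bounded by the powers of the inverse of the radius. -/
lemma eqOn_ball_tsum_iteratedFDeriv [CompleteSpace G] {g : E → G} {a : E} {c r : ℝ}
    {q : FormalMultilinearSeries ℝ E G} (hr : 0 < r) (hg : AnalyticOnNhd ℝ g (Metric.ball a r))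
    (hqdef : ∀ m, q m = ((m.factorial : ℝ)⁻¹ • iteratedFDeriv ℝ m g a))
    (hc : 0 ≤ c) (hq : ∀ m, 1 ≤ m → ‖q m‖ ≤ c ^ (m - 1)) (hcr : c * r ≤ 1) :
    Set.EqOn g (fun x => ∑' m, q m fun _ => x - a) (Metric.ball a r) := by
  have hrad := le_radius_of_norm_le_pow hc hq hr.le hcr
  have hps := q.hasFPowerSeriesOnBall ((ENNReal.ofReal_pos.2 hr).trans_le hrad)
  have hsum : AnalyticOnNhd ℝ (fun x => q.sum (x - a)) (Metric.ball a r) := by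
    intro x hx
    have hx' : x - a ∈ Metric.eball (0 : E) q.radius := by
      refine Metric.eball_subset_eball hrad ?_
      rw [Metric.eball_ofReal, mem_ball_zero_iff, ← dist_eq_norm]
      exact hx
    exact (hps.analyticOnNhd _ hx').comp (f := fun x => x - a)
      (analyticAt_id.sub analyticAt_const)
  -- Identity theorem: it is enough to have equality near `a`, where `g` has a convergent expansion.
  refine hg.eqOn_of_preconnected_of_eventuallyEq hsum (convex_ball a r).isPreconnected
    (Metric.mem_ball_self hr) ?_
  obtain ⟨p, ρ, hp⟩ := hg a (Metric.mem_ball_self hr)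
  filter_upwards [Metric.eball_mem_nhds a hp.r_pos] with x hx
  have hx' : x - a ∈ Metric.eball (0 : E) ρ := by
    simpa [Metric.mem_eball, edist_eq_enorm_sub] using hx
  have := hp.hasSum_iteratedFDeriv hx'
  rw [add_sub_cancel] at this
  rw [← this.tsum_eq]
  simp [hqdef]

end HomogeneousSeries

/-! ### Newton's step near a regular zero, and the convergence radius. -/

section Newton

variable {n : ℕ}

lemma norm_le_smaleGamma_pow {F : RSpace n → RSpace n} {a : RSpace n} (hγ : smaleGamma F a < ∞)
    {m : ℕ} (hm : 1 < m) :
    ‖((m.factorial : ℝ)⁻¹ • (fderiv ℝ F a).inverse.compContinuousMultilinearMap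
        (iteratedFDeriv ℝ m F a))‖ ≤ (smaleGamma F a).toReal ^ (m - 1) := by
  have h := le_iSup₂_of_le (f := fun (m : ℕ) (_ : 1 < m) =>
    ‖((m.factorial : ℝ)⁻¹ • (fderiv ℝ F a).inverse.compContinuousMultilinearMap
        (iteratedFDeriv ℝ m F a))‖ₑ ^ (1 / ((m : ℝ) - 1))) m hm le_rfl
  change _ ≤ smaleGamma F a at h
  have hm1 : (0 : ℝ) < ((m - 1 : ℕ) : ℝ) := by exact_mod_cast Nat.sub_pos_of_lt hm
  rw [show (m : ℝ) - 1 = ((m - 1 : ℕ) : ℝ) by rw [Nat.cast_sub hm.le, Nat.cast_one], one_div,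
    ENNReal.rpow_inv_le_iff hm1, ENNReal.rpow_natCast] at h
  have := ENNReal.toReal_mono (ENNReal.pow_ne_top hγ.ne) h
  rwa [toReal_enorm, ENNReal.toReal_pow] at this

/-- The linearization of an analytic map at a point near a regular zero: invertibility of the
derivative and the quadratic error bound of the Newton iteration. -/
lemma newton_estimate {Ω : Set (RSpace n)} {F : RSpace n → RSpace n} {a : RSpace n}
    (hF : AnalyticOnNhd ℝ F Ω) (hFa : F a = 0) (hinv : (fderiv ℝ F a).IsInvertible)
    (hγ : smaleGamma F a < ∞) {r : ℝ} (hball : Metric.ball a r ⊆ Ω)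
    (hr1 : (smaleGamma F a).toReal * r ≤ 1) {x : RSpace n} (hx : x ∈ Metric.ball a r)
    (hx1 : (smaleGamma F a).toReal * ‖x - a‖ < 1)
    (hx2 : 0 < 2 * (1 - (smaleGamma F a).toReal * ‖x - a‖) ^ 2 - 1) :
    (fderiv ℝ F x).IsInvertible ∧ ∀ s : RSpace n, fderiv ℝ F x s = -F x →
      ‖x + s - a‖ ≤ (smaleGamma F a).toReal * ‖x - a‖ ^ 2 /
        (2 * (1 - (smaleGamma F a).toReal * ‖x - a‖) ^ 2 - 1) := by
  set c := (smaleGamma F a).toReal with hcdef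
  have hc : 0 ≤ c := ENNReal.toReal_nonneg
  have hr : 0 < r := dist_nonneg.trans_lt hx
  have haΩ : a ∈ Ω := hball (Metric.mem_ball_self hr)
  set A := fderiv ℝ F a
  set B := A.inverse with hB
  -- Composing with `F'(a)⁻¹` turns the linear coefficient into the identity and makes `γ` control
  -- the higher ones.
  set g : RSpace n → RSpace n := B ∘ F with hg
  have hga : AnalyticOnNhd ℝ g (Metric.ball a r) := fun z hz =>
    (B.analyticAt _).comp (hF z (hball hz))
  set q : FormalMultilinearSeries ℝ (RSpace n) (RSpace n) :=
    fun m => (m.factorial : ℝ)⁻¹ • iteratedFDeriv ℝ m g a with hqdef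
  have hq0 : q 0 = 0 := by
    ext v; simp [hqdef, hg, hFa]
  have hder : ∀ z ∈ Ω, HasFDerivAt g (B ∘L fderiv ℝ F z) z := fun z hz =>
    B.hasFDerivAt.comp z (hF z hz).differentiableAt.hasFDerivAt
  have hq1app : ∀ v : Fin 1 → RSpace n, q 1 v = v 0 := by
    intro v
    simp [hqdef, iteratedFDeriv_one_apply, (hder a haΩ).fderiv, hB, A, hinv.inverse_apply_self]
  have hq : ∀ m, 1 ≤ m → ‖q m‖ ≤ c ^ (m - 1) := by
    intro m hm
    rcases hm.eq_or_lt with rfl | hm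
    · refine ContinuousMultilinearMap.opNorm_le_bound (by positivity) fun v => ?_
      simp [hq1app]
    · have := norm_le_smaleGamma_pow hγ hm
      rwa [← ContinuousLinearMap.iteratedFDeriv_comp_left _ (n := m) (hF a haΩ).contDiffAt
        le_rfl] at this
  have heq := eqOn_ball_tsum_iteratedFDeriv hr hga (q := q) (fun m => rfl) hc hq hr1
  have hT1 := norm_tsum_diagDeriv_sub_le hc hq hx1
  have hT2 := norm_tsum_diagDeriv_apply_sub_le hc hq hq0 hx1
  have hL := (hasFDerivAt_tsum_diag hc hq hx1).comp x ((hasFDerivAt_id x).sub_const a)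
  have hL' := (hL.congr_of_eventuallyEq
    (heq.eventuallyEq_of_mem (Metric.isOpen_ball.mem_nhds hx))).unique (hder x (hball hx))
  rw [ContinuousLinearMap.comp_id] at hL'
  set L := ∑' m, (q m).diagDeriv (x - a)
  have hid : (q 1).diagDeriv (x - a) = ContinuousLinearMap.id ℝ _ := by
    ext1 v; simp [ContinuousMultilinearMap.diagDeriv_apply, hq1app]
  rw [hid] at hT1
  have hgx := heq hx
  simp only at hgx
  rw [← hgx] at hT2
  set t := ‖x - a‖
  have hpos : 0 < (1 - c * t) ^ 2 := pow_pos (by linarith) 2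
  -- From `‖L - id‖ ≤ 1/(1-ct)² - 1`, cleared of denominators. It yields injectivity, hence
  -- invertibility in finite dimension, and also the Newton bound.
  have hlow : ∀ v, (2 * (1 - c * t) ^ 2 - 1) * ‖v‖ ≤ (1 - c * t) ^ 2 * ‖L v‖ := by
    intro v
    have h1 := (L - ContinuousLinearMap.id ℝ _).le_of_opNorm_le hT1 v
    rw [sub_apply, ContinuousLinearMap.id_apply] at h1
    have h2 := norm_sub_norm_le v (v - L v)
    rw [sub_sub_cancel, norm_sub_rev v] at h2
    have h3 : (2 - 1 / (1 - c * t) ^ 2) * ‖v‖ ≤ ‖L v‖ := by linarith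
    have hne := hpos.ne'
    calc (2 * (1 - c * t) ^ 2 - 1) * ‖v‖
        = (1 - c * t) ^ 2 * ((2 - 1 / (1 - c * t) ^ 2) * ‖v‖) := by
          rw [← mul_assoc, mul_sub, mul_one_div_cancel hne, mul_comm 2]
      _ ≤ _ := by gcongr
  constructor
  · have hinj : Function.Injective (fderiv ℝ F x : RSpace n →ₗ[ℝ] RSpace n) := by
      refine (injective_iff_map_eq_zero _).2 fun v hv => ?_
      have h0 : L v = 0 := by
        rw [hL', ContinuousLinearMap.comp_apply]
        exact (congrArg B hv).trans (map_zero B)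
      have := hlow v
      rw [h0, norm_zero, mul_zero] at this
      exact norm_le_zero_iff.1 (nonpos_of_mul_nonpos_right this hx2)
    exact ⟨(LinearEquiv.ofInjectiveEndo _ hinj).toContinuousLinearEquiv, by ext; simp⟩
  · intro s hs
    have hLs : L s = -g x := by
      rw [hL', ContinuousLinearMap.comp_apply, hs, map_neg]; rfl
    -- The Newton error, seen through `L`, is exactly the linearization error.
    have h1 : L (x + s - a) = L (x - a) - g x := by
      rw [add_sub_right_comm, map_add, hLs, ← sub_eq_add_neg]
    have h2 := hlow (x + s - a)
    rw [h1] at h2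
    rw [le_div_iff₀ hx2, mul_comm]
    refine h2.trans ?_
    rw [le_div_iff₀ hpos] at hT2
    linarith

/-- With `u = γ‖x - a‖`, the last inequality reads `2(1-λ)u² - (5-3λ)u + (1-λ) > 0`; the second term
of the radius, times `γ`, is the smaller root. -/
lemma exists_ball_of_mem_smaleRadius {Ω : Set (RSpace n)} {a x : RSpace n} {γ : ℝ≥0∞}
    (hγ : γ < ∞) {lam : ℝ} (hlam1 : lam < 1)
    (hx : x ∈ Metric.eball a (smaleRadius Ω a γ lam)) :
    (∃ r, Metric.ball a r ⊆ Ω ∧ γ.toReal * r ≤ 1 ∧ x ∈ Metric.ball a r) ∧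
      γ.toReal * ‖x - a‖ < 1 ∧
      (1 + lam) * (γ.toReal * ‖x - a‖) <
        (1 - lam) * (2 * (1 - γ.toReal * ‖x - a‖) ^ 2 - 1) := by
  rw [Metric.mem_eball, smaleRadius, lt_min_iff] at hx
  obtain ⟨hx1, hx2⟩ := hx
  obtain ⟨r, ⟨hr1, hr2⟩, hxr⟩ := lt_sSup_iff.1 hx1
  have hrtop : r ≠ ∞ := hr1.ne_top
  have hrγ : r * γ < 1 := by
    by_cases h0 : γ = 0
    · simp [h0]
    · exact (ENNReal.lt_div_iff_mul_lt (Or.inl h0) (Or.inl hγ.ne)).1 hr1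
  have hrγ' : γ.toReal * r.toReal < 1 := by
    rw [mul_comm, ← ENNReal.toReal_mul]
    simpa using (ENNReal.toReal_lt_toReal hrγ.ne_top ENNReal.one_ne_top).2 hrγ
  have hdist : ‖x - a‖ < r.toReal := by
    rw [← dist_eq_norm, dist_edist]
    exact (ENNReal.toReal_lt_toReal (edist_ne_top _ _) hrtop).2 hxr
  have hγ0 : 0 ≤ γ.toReal := ENNReal.toReal_nonneg
  refine ⟨⟨r.toReal, ?_, hrγ'.le, by rwa [Metric.mem_ball, dist_eq_norm]⟩, ?_, ?_⟩
  · rw [← Metric.eball_ofReal, ENNReal.ofReal_toReal hrtop]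
    exact hr2
  · exact (mul_le_mul_of_nonneg_left hdist.le hγ0).trans_lt hrγ'
  · have hlt : edist x a * (ENNReal.ofReal (4 * (1 - lam)) * γ) <
        ENNReal.ofReal (5 - 3 * lam - √((5 - 3 * lam) ^ 2 - 8 * (1 - lam) ^ 2)) ∨ γ = 0 := by
      by_cases h0 : γ = 0
      · exact Or.inr h0
      · refine Or.inl ((ENNReal.lt_div_iff_mul_lt (Or.inl ?_) (Or.inl ?_)).1 hx2)
        · exact mul_ne_zero (ENNReal.ofReal_pos.2 (by linarith)).ne' h0
        · exact ENNReal.mul_ne_top ENNReal.ofReal_ne_top hγ.ne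
    rcases hlt with hlt | rfl
    · have h1 := (ENNReal.toReal_lt_toReal hlt.ne_top ENNReal.ofReal_ne_top).2 hlt
      have hpos : 0 < 5 - 3 * lam - √((5 - 3 * lam) ^ 2 - 8 * (1 - lam) ^ 2) :=
        ENNReal.ofReal_pos.1 (bot_le.trans_lt hlt)
      rw [ENNReal.toReal_ofReal hpos.le, ENNReal.toReal_mul, ENNReal.toReal_mul,
        ENNReal.toReal_ofReal (by linarith), ← dist_edist, dist_eq_norm] at h1
      set u := γ.toReal * ‖x - a‖ with hu
      have h2 : √((5 - 3 * lam) ^ 2 - 8 * (1 - lam) ^ 2) < 5 - 3 * lam - 4 * (1 - lam) * u := by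
        rw [hu]; linarith
      have h3 := (Real.sqrt_lt' ((Real.sqrt_nonneg _).trans_lt h2)).1 h2
      have h4 : 0 < 8 * (1 - lam) * ((1 - lam) * (2 * (1 - u) ^ 2 - 1) - (1 + lam) * u) := by
        nlinarith
      have := (pos_iff_pos_of_mul_pos h4).1 (by linarith)
      linarith
    · simp only [ENNReal.toReal_zero, zero_mul, mul_zero, sub_zero]
      linarith

end Newton

/-! ### Scalar inequalities and the majorizing sequence. -/

lemma le_add_sqrt_mul_of_sq_le {w e s t N θ lam : ℝ} (he0 : 0 ≤ e) (heN : e ≤ N) (ht : 0 ≤ t)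
    (hs0 : 0 ≤ s) (hs : s ≤ N + t) (hθ0 : 0 ≤ θ) (hθ : √(2 * θ) ≤ lam)
    (hN : (1 + lam) * N ≤ (1 - lam) * t) (hw : w ^ 2 ≤ e ^ 2 + 2 * (θ * s ^ 2)) :
    w ≤ N + √(2 * θ) * t := by
  set l := √(2 * θ) with hl
  have hl0 : 0 ≤ l := Real.sqrt_nonneg _
  have hl2 : l ^ 2 = 2 * θ := Real.sq_sqrt (by linarith)
  have hN0 : 0 ≤ N := he0.trans heN
  refine abs_le_of_sq_le_sq' ?_ (by positivity) |>.2
  have h1 : e ^ 2 ≤ N ^ 2 := pow_le_pow_left₀ he0 heN 2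
  have h2 : s ^ 2 ≤ (N + t) ^ 2 := pow_le_pow_left₀ hs0 hs 2
  -- After cancelling common terms in `N² + l²(N+t)² ≤ (N + lt)²`, this times `lN` remains. It
  -- avoids the factor `1 + l` on `N` that subadditivity of the root would cost.
  have h3 : l * (N + 2 * t) ≤ 2 * t := by
    have h4 : l * (N + 2 * t) ≤ lam * (N + 2 * t) := by gcongr
    nlinarith
  have h5 : l * N * (l * (N + 2 * t)) ≤ l * N * (2 * t) := by gcongr
  have h6 : l ^ 2 * s ^ 2 ≤ l ^ 2 * (N + t) ^ 2 := by gcongr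
  nlinarith

section Scalar

variable {γ lam t t₀ : ℝ}

lemma two_mul_one_sub_sq_anti (hγ : 0 ≤ γ) (ht : t ≤ t₀) (h1 : γ * t₀ < 1) :
    2 * (1 - γ * t₀) ^ 2 - 1 ≤ 2 * (1 - γ * t) ^ 2 - 1 := by
  have : γ * t ≤ γ * t₀ := by gcongr
  have : (1 - γ * t₀) ^ 2 ≤ (1 - γ * t) ^ 2 := pow_le_pow_left₀ (by linarith) (by linarith) 2
  linarith

lemma smale_denominator_pos (hγ : 0 ≤ γ) (hlam0 : 0 ≤ lam) (hlam1 : lam < 1) (ht₀ : 0 ≤ t₀)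
    (h2 : (1 + lam) * (γ * t₀) < (1 - lam) * (2 * (1 - γ * t₀) ^ 2 - 1)) :
    0 < 2 * (1 - γ * t₀) ^ 2 - 1 := by
  have h3 : 0 < (1 - lam) * (2 * (1 - γ * t₀) ^ 2 - 1) := lt_of_le_of_lt (by positivity) h2
  exact (pos_iff_pos_of_mul_pos h3).1 (by linarith)

/-- The radius condition at `t₀` passes to smaller `t`: its left side shrinks and the denominator
grows. -/
lemma smale_contraction (hγ : 0 ≤ γ) (hlam0 : 0 ≤ lam) (hlam1 : lam < 1) (ht₀ : 0 ≤ t₀)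
    (h1 : γ * t₀ < 1) (h2 : (1 + lam) * (γ * t₀) < (1 - lam) * (2 * (1 - γ * t₀) ^ 2 - 1))
    (ht0 : 0 ≤ t) (ht : t ≤ t₀) :
    (1 + lam) * (γ * t ^ 2 / (2 * (1 - γ * t) ^ 2 - 1)) ≤ (1 - lam) * t := by
  have hd := smale_denominator_pos hγ hlam0 hlam1 ht₀ h2
  have hdt := two_mul_one_sub_sq_anti hγ ht h1
  rw [← mul_div_assoc, div_le_iff₀ (hd.trans_le hdt)]
  have h3 : (1 + lam) * (γ * t) ≤ (1 - lam) * (2 * (1 - γ * t) ^ 2 - 1) :=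
    calc (1 + lam) * (γ * t) ≤ (1 + lam) * (γ * t₀) := by gcongr
      _ ≤ _ := h2.le
      _ ≤ _ := mul_le_mul_of_nonneg_left hdt (by linarith)
  nlinarith [mul_le_mul_of_nonneg_left h3 ht0]

lemma smaleSeq_mem_Icc {θ : ℕ → ℝ} (hγ : 0 ≤ γ) (hlam0 : 0 ≤ lam) (hlam1 : lam < 1)
    (hθ : ∀ k, √(2 * θ k) ≤ lam) (ht₀ : 0 ≤ t₀) (h1 : γ * t₀ < 1)
    (h2 : (1 + lam) * (γ * t₀) < (1 - lam) * (2 * (1 - γ * t₀) ^ 2 - 1)) (k : ℕ) :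
    smaleSeq γ lam θ t₀ k ∈ Set.Icc 0 t₀ := by
  induction k with
  | zero => exact ⟨ht₀, le_rfl⟩
  | succ k ih =>
    have hd := (smale_denominator_pos hγ hlam0 hlam1 ht₀ h2).trans_le
      (two_mul_one_sub_sq_anti hγ ih.2 h1)
    have hc := smale_contraction hγ hlam0 hlam1 ht₀ h1 h2 ih.1 ih.2
    have hl := mul_le_mul_of_nonneg_right (hθ k) ih.1
    have h0 := ih.1
    rw [smaleSeq, mul_assoc (1 + lam), mul_div_assoc]
    exact ⟨by positivity, by linarith [ih.2]⟩

end Scalar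

/-! ### Contraction of the iterates and the main theorem. -/

/-- One iteration of the Newton-CondG method inside the convergence ball. -/
lemma NewtonCondGStep.mem_and_norm_le {n : ℕ} {Ω C : Set (RSpace n)}
    {F : RSpace n → RSpace n} {xs : RSpace n} (hCconv : Convex ℝ C) (hCcomp : IsCompact C)
    (hF : AnalyticOnNhd ℝ F Ω) (hxs : xs ∈ C) (hFxs : F xs = 0)
    (hinv : (fderiv ℝ F xs).IsInvertible) (hγ : smaleGamma F xs < ∞)
    {lam : ℝ} (hlam0 : 0 ≤ lam) (hlam1 : lam < 1) {θ : ℝ} (hθ0 : 0 ≤ θ) (hθ : √(2 * θ) ≤ lam)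
    {x x' : RSpace n} (hxC : x ∈ C)
    (hxB : x ∈ Metric.eball xs (smaleRadius Ω xs (smaleGamma F xs) lam))
    (hstep : NewtonCondGStep F C θ x x') :
    x' ∈ C ∧ ‖x' - xs‖ ≤ (smaleGamma F xs).toReal * ‖x - xs‖ ^ 2 /
      (2 * (1 - (smaleGamma F xs).toReal * ‖x - xs‖) ^ 2 - 1) + √(2 * θ) * ‖x - xs‖ := by
  obtain ⟨⟨r, hr, hr1, hxr⟩, hx1, hx2⟩ := exists_ball_of_mem_smaleRadius hγ hlam1 hxB
  have hc : 0 ≤ (smaleGamma F xs).toReal := ENNReal.toReal_nonneg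
  have hd := smale_denominator_pos hc hlam0 hlam1 (norm_nonneg _) hx2
  obtain ⟨-, hN⟩ := newton_estimate hF hFxs hinv hγ hr hr1 hxr hx1 hd
  rcases hstep with ⟨hFx, rfl⟩ | ⟨-, s, hs, hout⟩
  · refine ⟨hxC, ?_⟩
    -- When `F x = 0`, the zero vector is a Newton step, so the Newton bound applies to `x` itself.
    have := hN 0 (by simp [hFx])
    rw [add_zero] at this
    exact this.trans (le_add_of_nonneg_right (by positivity))
  · have hε : 0 ≤ θ * ‖s‖ ^ 2 := by positivity
    refine ⟨hout.mem hCconv hCcomp hε hxC, ?_⟩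
    refine le_add_sqrt_mul_of_sq_le (norm_nonneg _) (hN s hs) (norm_nonneg _) (norm_nonneg s) ?_
      hθ0 hθ
      (smale_contraction hc hlam0 hlam1 (norm_nonneg _) hx1 hx2 (norm_nonneg _) le_rfl)
      (hout.norm_sub_sq_le hCconv hCcomp hε hxC hxs)
    calc ‖s‖ = ‖(x + s - xs) - (x - xs)‖ := by congr 1; abel
      _ ≤ ‖x + s - xs‖ + ‖x - xs‖ := norm_sub_le _ _
      _ ≤ _ := by gcongr; exact hN s hs

theorem theorem4p2 {n : ℕ} (Ω C : Set (RSpace n)) (F : RSpace n → RSpace n) (xs : RSpace n)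
    (hΩ : IsOpen Ω) (hCΩ : C ⊆ Ω) (hCconv : Convex ℝ C) (hCcomp : IsCompact C)
    (hF : AnalyticOnNhd ℝ F Ω)
    (hxs : xs ∈ C) (hFxs : F xs = 0) (hinv : (fderiv ℝ F xs).IsInvertible)
    (hγ : smaleGamma F xs < ∞)
    (lam : ℝ) (hlam0 : 0 ≤ lam) (hlam1 : lam < 1)
    (θ : ℕ → ℝ) (hθ : ∀ k, 0 ≤ θ k ∧ θ k ≤ lam ^ 2 / 2)
    (x₀ : RSpace n) (hx₀C : x₀ ∈ C)
    (hx₀B : x₀ ∈ Metric.eball xs (smaleRadius Ω xs (smaleGamma F xs) lam)) (hx₀ : x₀ ≠ xs) :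
    -- The method never breaks down, whatever choices have been made before.
    (∀ (N : ℕ) (x : ℕ → RSpace n), x 0 = x₀ →
      (∀ k < N, NewtonCondGStep F C (θ k) (x k) (x (k + 1))) →
      (fderiv ℝ F (x N)).IsInvertible ∧
      (F (x N) ≠ 0 → ∀ s : RSpace n, fderiv ℝ F (x N) s = -F (x N) →
        s ≠ 0 ∧ CondGWellDefined C (x N + s) (x N) (θ N * ‖s‖ ^ 2))) ∧
    -- It generates a sequence.
    (∃ x : ℕ → RSpace n, x 0 = x₀ ∧ ∀ k, NewtonCondGStep F C (θ k) (x k) (x (k + 1))) ∧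
    -- Every sequence that it generates has the asserted properties.
    (∀ x : ℕ → RSpace n, x 0 = x₀ →
      (∀ k, NewtonCondGStep F C (θ k) (x k) (x (k + 1))) →
      (∀ k, x k ∈ Metric.eball xs (smaleRadius Ω xs (smaleGamma F xs) lam) ∩ C) ∧
      Tendsto x atTop (𝓝 xs) ∧
      (∀ k, ‖x (k + 1) - xs‖ ≤
        (smaleGamma F xs).toReal / (2 * (1 - (smaleGamma F xs).toReal * ‖x₀ - xs‖) ^ 2 - 1)
            * ‖x k - xs‖ ^ 2
          + √(2 * θ k) * ‖x k - xs‖) ∧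
      (∀ k, ‖x (k + 1) - xs‖ ≤
        smaleSeq (smaleGamma F xs).toReal lam θ ‖x₀ - xs‖ (k + 1))) := by
  set r := smaleRadius Ω xs (smaleGamma F xs) lam
  set γ := (smaleGamma F xs).toReal with hγdef
  have hc : 0 ≤ γ := ENNReal.toReal_nonneg
  have hl : ∀ k, √(2 * θ k) ≤ lam := fun k =>
    Real.sqrt_le_iff.2 ⟨hlam0, by linarith [(hθ k).2]⟩
  obtain ⟨-, h₀1, h₀2⟩ := exists_ball_of_mem_smaleRadius hγ hlam1 hx₀B
  rw [← hγdef] at h₀1 h₀2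
  set t₀ := ‖x₀ - xs‖ with ht₀
  have ht₀0 : 0 ≤ t₀ := norm_nonneg _
  have hd₀ := smale_denominator_pos hc hlam0 hlam1 ht₀0 h₀2
  have hmem : ∀ z, ‖z - xs‖ ≤ t₀ → z ∈ Metric.eball xs r := fun z hz => by
    refine lt_of_le_of_lt ?_ (Metric.mem_eball.1 hx₀B)
    rw [edist_dist, edist_dist, dist_eq_norm, dist_eq_norm]
    exact ENNReal.ofReal_le_ofReal hz
  have hstep : ∀ k x x', x ∈ C → ‖x - xs‖ ≤ t₀ → NewtonCondGStep F C (θ k) x x' →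
      x' ∈ C ∧ ‖x' - xs‖ ≤ γ * ‖x - xs‖ ^ 2 / (2 * (1 - γ * ‖x - xs‖) ^ 2 - 1)
        + √(2 * θ k) * ‖x - xs‖ := fun k x x' hx hxt h =>
    h.mem_and_norm_le hCconv hCcomp hF hxs hFxs hinv hγ hlam0 hlam1 (hθ k).1 (hl k) hx
      (hmem x hxt)
  have hbound : ∀ k t, 0 ≤ t → t ≤ t₀ →
      γ * t ^ 2 / (2 * (1 - γ * t) ^ 2 - 1) + √(2 * θ k) * t ≤
        γ / (2 * (1 - γ * t₀) ^ 2 - 1) * t ^ 2 + √(2 * θ k) * t := by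
    intro k t ht0 ht
    have := two_mul_one_sub_sq_anti hc ht h₀1
    rw [div_mul_eq_mul_div]
    gcongr
  have hρ : γ * t₀ / (2 * (1 - γ * t₀) ^ 2 - 1) + lam < 1 := by
    rw [← lt_sub_iff_add_lt, div_lt_iff₀ hd₀]
    nlinarith [mul_nonneg hlam0 (mul_nonneg hc ht₀0)]
  set ρ := γ * t₀ / (2 * (1 - γ * t₀) ^ 2 - 1) + lam with hρdef
  have hρ0 : 0 ≤ ρ := by positivity
  have hcontr : ∀ k t, 0 ≤ t → t ≤ t₀ →
      γ / (2 * (1 - γ * t₀) ^ 2 - 1) * t ^ 2 + √(2 * θ k) * t ≤ ρ * t := by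
    intro k t ht0 ht
    calc _ ≤ γ / (2 * (1 - γ * t₀) ^ 2 - 1) * (t₀ * t) + lam * t := by
          rw [pow_two t]
          gcongr
          exact hl k
      _ = ρ * t := by rw [hρdef]; ring
  -- Stated for finite runs, so that it serves both the absence of breakdown and the construction of
  -- a sequence.
  have hinvar : ∀ (N : ℕ) (x : ℕ → RSpace n), x 0 = x₀ →
      (∀ k < N, NewtonCondGStep F C (θ k) (x k) (x (k + 1))) → ∀ k ≤ N,
      x k ∈ C ∧ ‖x k - xs‖ ≤ t₀ ∧ ‖x k - xs‖ ≤ ρ ^ k * t₀ := by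
    intro N x h0 hx k
    induction k with
    | zero => intro _; rw [h0]; exact ⟨hx₀C, le_rfl, by simp [ht₀]⟩
    | succ k ih =>
      intro hk
      obtain ⟨h1, h2, h3⟩ := ih (by lia)
      obtain ⟨h4, h5⟩ := hstep k _ _ h1 h2 (hx k (by lia))
      have h6 := h5.trans ((hbound k _ (norm_nonneg _) h2).trans
        (hcontr k _ (norm_nonneg _) h2))
      have h7 : ρ * ‖x k - xs‖ ≤ ‖x k - xs‖ := mul_le_of_le_one_left (norm_nonneg _) hρ.le
      refine ⟨h4, by linarith, h6.trans ?_⟩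
      rw [pow_succ', mul_assoc]
      gcongr
  have hregular : ∀ x, ‖x - xs‖ ≤ t₀ → (fderiv ℝ F x).IsInvertible := by
    intro x hx
    obtain ⟨⟨R, hR, hR1, hxR⟩, hx1, hx2⟩ := exists_ball_of_mem_smaleRadius hγ hlam1 (hmem x hx)
    exact (newton_estimate hF hFxs hinv hγ hR hR1 hxR hx1
      (smale_denominator_pos hc hlam0 hlam1 (norm_nonneg _) hx2)).1
  refine ⟨fun N x h0 hx => ?_, ?_, fun x h0 hx => ?_⟩
  · obtain ⟨hC, ht, -⟩ := hinvar N x h0 hx N le_rfl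
    refine ⟨hregular _ ht, fun hne s hs => ⟨?_, ?_⟩⟩
    · rintro rfl
      rw [map_zero, eq_comm, neg_eq_zero] at hs
      exact hne hs
    · exact condGWellDefined hCconv hCcomp (mul_nonneg (hθ N).1 (sq_nonneg _)) hC
  · have hnext : ∀ k x, x ∈ C → ‖x - xs‖ ≤ t₀ → ∃ x', NewtonCondGStep F C (θ k) x x' := by
      intro k x hxC hxt
      by_cases hFx : F x = 0
      · exact ⟨x, Or.inl ⟨hFx, rfl⟩⟩
      · obtain ⟨s, hs⟩ := (hregular x hxt).surjective (-F x)
        obtain ⟨w, hw⟩ := exists_isCondGOutput (y := x + s) hCconv hCcomp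
          (mul_nonneg (hθ k).1 (sq_nonneg ‖s‖)) hxC
        exact ⟨w, Or.inr ⟨hFx, s, hs, hw⟩⟩
    choose! f hf using hnext
    set x : ℕ → RSpace n := fun k => Nat.rec x₀ (fun k z => f k z) k with hxdef
    have hrun : ∀ N, ∀ k < N, NewtonCondGStep F C (θ k) (x k) (x (k + 1)) := by
      intro N
      induction N with
      | zero => intro k hk; lia
      | succ N ih =>
        intro k hk
        rcases Nat.lt_succ_iff_lt_or_eq.1 hk with hk | rfl
        · exact ih k hk
        · obtain ⟨h1, h2, -⟩ := hinvar k x rfl ih k le_rfl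
          exact hf k _ h1 h2
    exact ⟨x, rfl, fun k => hrun (k + 1) k k.lt_succ_self⟩
  · have hall : ∀ k, x k ∈ C ∧ ‖x k - xs‖ ≤ t₀ ∧ ‖x k - xs‖ ≤ ρ ^ k * t₀ := fun k =>
      hinvar k x h0 (fun j _ => hx j) k le_rfl
    have hnewton := fun k => (hstep k _ _ (hall k).1 (hall k).2.1 (hx k)).2
    refine ⟨fun k => ⟨hmem _ (hall k).2.1, (hall k).1⟩, ?_, fun k =>
      (hnewton k).trans (hbound k _ (norm_nonneg _) (hall k).2.1), fun k => ?_⟩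
    · rw [tendsto_iff_norm_sub_tendsto_zero]
      refine squeeze_zero (fun k => norm_nonneg _) (fun k => (hall k).2.2) ?_
      simpa using (tendsto_pow_atTop_nhds_zero_of_lt_one hρ0 hρ).mul_const t₀
    · have hseq := smaleSeq_mem_Icc hc hlam0 hlam1 hl ht₀0 h₀1 h₀2
      -- The scalar recursion is monotone on `[0, t₀]`, and its extra factor `1 + λ` only enlarges
      -- the bound.
      have hsucc : ∀ k, ‖x k - xs‖ ≤ smaleSeq γ lam θ t₀ k →
          ‖x (k + 1) - xs‖ ≤ smaleSeq γ lam θ t₀ (k + 1) := by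
        intro k ih
        refine (hnewton k).trans ?_
        have hd := hd₀.trans_le (two_mul_one_sub_sq_anti hc (hseq k).2 h₀1)
        have hdt := two_mul_one_sub_sq_anti hc ih
          ((mul_le_mul_of_nonneg_left (hseq k).2 hc).trans_lt h₀1)
        rw [smaleSeq]
        gcongr
        nlinarith [mul_nonneg hlam0 hc]
      have hle : ∀ k, ‖x k - xs‖ ≤ smaleSeq γ lam θ t₀ k := by
        intro k
        induction k with
        | zero => rw [h0]; exact le_rfl
        | succ k ih => exact hsucc k ih
      exact hle (k + 1)
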